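/- A \emph{Bell scenario} $\mathcal B=(\mathsf N,\mathsf M,\rho)$ consists of finite-dimensional POVMs $\mathsf N=\{\{N_{a|x}\}_a\}_x$ for Alice and $\mathsf M=\{\{M_{b|y}\}_b\}_y$ for Bob and a bipartite density matrix $\rho$; its statistics are $p(ab|xy)=\mathrm{Tr}[\rho\,(N_{a|x}\otimes M_{b|y})]$. For a family $\mathsf E=\{E_{a|x}\}$ let $\mathcal O_{\rm a}(\mathsf E)=\{\alpha\ \text{real}:\sum_{a,x}\alpha_{a,x}E_{a|x}=0\}$ (all operational identities), and let $\mathcal O_{\rm t}(\mathsf E)\subseteq\mathcal O_{\rm a}(\mathsf E)$ (the trivial ones) be the linear span of the identities $\sum_aE_{a|x}=\sum_aE_{a|x'}$. For $i,j,u,v\in\{\mathrm a,\mathrm t\}$ put $$\mathcal O_{ijuv}(\mathcal B)=\mathcal O_i(\mathsf N)\cup\mathcal O_j(\mathsf M)\cup\mathcal O_u(\mathsf N\circ\rho)\cup\mathcal O_v(\mathsf M\circ\rho)$$ (identities of different families being regarded as distinct), where $\mathsf N\circ\rho=\{\mathrm{Tr}_A[(N_{a|x}\otimes 1)\rho]\}$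 and $\mathsf M\circ\rho=\{\mathrm{Tr}_B[(1\otimes M_{b|y})\rho]\}$. Let $\mathcal{NC}_{ijuv}$ be the set of all real arrays $(p(ab|xy))$ of the form $$p(ab|xy)=\sum_{\lambda_A,\lambda_B}p(\lambda_A\lambda_B)\,p(a|x,\lambda_A)\,p(b|y,\lambda_B)$$ with a probability distribution $p(\lambda_A\lambda_B)$ on a product of two finite sets and response functions (nonnegative, summing to $1$ over the outcomes) such that $\sum\alpha_{a,x}\,p(a|x,\lambda_A)=0$ for all $\lambda_A$ and $\alpha\in\mathcal O_i(\mathsf N)$, $\sum\beta_{b,y}\,p(b|y,\lambda_B)=0$ for all $\lambda_B$ and $\beta\in\mathcal O_j(\mathsf M)$, $\sum\alpha_{a,x}\sum_{\lambda_A}p(a|x,\lambda_A)p(\lambda_A\lambda_B)=0$ for all $\lambda_B$ and $\alpha\in\mathcal O_u(\mathsf N\circ\rho)$, and $\sum\beta_{b,y}\sum_{\lambda_B}p(b|y,\lambda_B)p(\lambda_A\lambda_B)=0$ for all $\lambda_A$ and $\beta\in\mathcal O_v(\mathsf M\circ\rho)$. Let $\phi=\frac{1+\sqrt5}{2}$ and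 $$\begin{aligned} \vec m_0&=[0,1,\phi],&\vec m_1&=[0,1,-\phi],&\vec m_2&=[1,\phi,0],\\ \vec m_3&=[1,-\phi,0],&\vec m_4&=[\phi,0,1],&\vec m_5&=[\phi,0,-1],\\ \vec n_0&=[-1,-1,-1],&\vec n_1&=[-\phi,\tfrac1\phi,0],&\vec n_2&=[-\phi,-\tfrac1\phi,0],\\ \vec n_3&=[-1,-1,1],&\vec n_4&=[0,-\phi,\tfrac1\phi],&\vec n_5&=[1,-1,-1],\\ \vec n_6&=[0,-\phi,-\tfrac1\phi],&\vec n_7&=[-1,1,-1],&\vec n_8&=[-\tfrac1\phi,0,-\phi],\\ \vec n_9&=[\tfrac1\phi,0,-\phi], \end{aligned}$$ so that $\pm\vec m_x$ are the $12$ vertices of a regular icosahedron and $\pm\vec n_y$ the $20$ vertices of a regular dodecahedron. A Bell scenario with $6$ two-outcome measurements for Alice and $10$ two-outcome measurements for Bob is an \emph{(icosahedron, dodecahedron) scenario} if $\mathcal O_{\rm a}(\mathsf N)=\{\alpha:\sum\alpha_{a,x}=0,\ \sum\alpha_{a,x}(-1)^a\vec m_x=0\}$ and $\mathcal O_{\rm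 a}(\mathsf M)=\{\beta:\sum\beta_{b,y}=0,\ \sum\beta_{b,y}(-1)^b\vec n_y=0\}$, i.e. the effects satisfy exactly the (affine) identities of the labelled vertices. \textbf{(1)} For every (icosahedron, dodecahedron) Bell scenario, the inclusions $$\mathcal O_{\rm tttt}\subset\mathcal O_{\rm attt},\mathcal O_{\rm tatt}\subset\mathcal O_{\rm aatt}\qquad\text{and}\qquad \mathcal{NC}_{\rm aatt}\subset\mathcal{NC}_{\rm attt},\mathcal{NC}_{\rm tatt}\subset\mathcal{NC}_{\rm tttt}$$ hold and are all strict; $\mathcal{NC}_{\rm aatt}$ is a polytope; and $\mathcal I\ge0$ is a facet-defining inequality of it (valid on $\mathcal{NC}_{\rm aatt}$, with $\{p\in\mathcal{NC}_{\rm aatt}:\mathcal I=0\}$ nonempty and of dimension $\dim\mathcal{NC}_{\rm aatt}-1$), where $$\begin{aligned}\mathcal I={}&p(00|00)+p(00|01)-(\phi+1)p(00|02)+\tfrac1\phi p(00|03)\\&+\tfrac1\phi p(00|10)+\tfrac1\phi p(00|11)-2p(00|12)+p(00|13)\\&-p(00|20)-\tfrac1\phi p(00|21)+(\phi+1)p(00|22)-p(00|23)\\&-\tfrac1{\phi^2}p(10|11)+\tfrac1\phi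 p(10|12).\end{aligned}$$ \textbf{(2)} Let $N_{a|x}=\frac12\bigl(1+(-1)^a\frac{1}{\sqrt{1+\phi^2}}\vec m_x\cdot\vec\sigma\bigr)$ and $M_{b|y}=\frac12\bigl(1+(-1)^b\frac1{\sqrt3}\vec n_y\cdot\vec\sigma\bigr)$, with $\vec\sigma$ the Pauli matrices, and let $\rho^p=p\,|\Phi^+\rangle\langle\Phi^+|+(1-p)\frac{1}{4}$ with $|\Phi^+\rangle=(|00\rangle+|11\rangle)/\sqrt2$. For every $p$ with $\sqrt{\frac{1+\phi^2}{3\phi^4}}<p\le1$, the triple $(\mathsf N,\mathsf M,\rho^p)$ is an (icosahedron, dodecahedron) Bell scenario and its statistics violate the inequality: $\mathcal I<0$. The threshold satisfies $\left|\sqrt{\frac{1+\phi^2}{3\phi^4}}-0.4195\right|<5\cdot10^{-5}$. -/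

import Mathlib

open scoped Kronecker ComplexOrder goldenRatio

noncomputable section

namespace Bell

/-! ## Bell scenarios -/

/-- A bipartite Bell scenario `(N, M, ρ)`: Alice has settings `x : X` with outcomes `a : A`, Bob has
settings `y : Y` with outcomes `b : B`; `N a x` is the effect `N_{a|x}`, `M b y` is `M_{b|y}`. -/
structure Scenario (A B X Y : Type) (dA dB : ℕ) where
  N : A → X → Matrix (Fin dA) (Fin dA) ℂ
  M : B → Y → Matrix (Fin dB) (Fin dB) ℂ
  ρ : Matrix (Fin dA × Fin dB) (Fin dA × Fin dB) ℂ

/-- `E a x`, `a : A`, is a positive operator-valued measure for every setting `x`. -/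
def IsPOVMFamily {A X : Type} [Fintype A] {d : ℕ} (E : A → X → Matrix (Fin d) (Fin d) ℂ) : Prop :=
  (∀ a x, (E a x).PosSemidef) ∧ ∀ x, ∑ a, E a x = 1

def IsDensityMatrix {ι : Type} [Fintype ι] (ρ : Matrix ι ι ℂ) : Prop :=
  ρ.PosSemidef ∧ ρ.trace = 1

/-- The data really are local measurements and a bipartite quantum state. -/
def Scenario.IsQuantum {A B X Y : Type} [Fintype A] [Fintype B] {dA dB : ℕ}
    (S : Scenario A B X Y dA dB) : Prop :=
  IsPOVMFamily S.N ∧ IsPOVMFamily S.M ∧ IsDensityMatrix S.ρ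

/-- Bipartite statistics: `p a b x y` is `p(ab|xy)`. -/
abbrev Stat (A B X Y : Type) : Type := A → B → X → Y → ℝ

/-- `p(ab|xy) = Tr[ρ (N_{a|x} ⊗ M_{b|y})]` (a real number in a quantum scenario). -/
def Scenario.statistics {A B X Y : Type} {dA dB : ℕ} (S : Scenario A B X Y dA dB) :
    Stat A B X Y :=
  fun a b x y => (S.ρ * (S.N a x ⊗ₖ S.M b y)).trace.re

/-! ## Operational identities -/

def traceLeft {dA dB : ℕ} (T : Matrix (Fin dA × Fin dB) (Fin dA × Fin dB) ℂ) :
    Matrix (Fin dB) (Fin dB) ℂ :=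
  Matrix.of fun j j' => ∑ i, T (i, j) (i, j')

def traceRight {dA dB : ℕ} (T : Matrix (Fin dA × Fin dB) (Fin dA × Fin dB) ℂ) :
    Matrix (Fin dA) (Fin dA) ℂ :=
  Matrix.of fun i i' => ∑ j, T (i, j) (i', j)

/-- The steering assemblage `N ∘ ρ` on Bob's system: `Tr_A[(N_{a|x} ⊗ 1) ρ]`. -/
def Scenario.steerB {A B X Y : Type} {dA dB : ℕ} (S : Scenario A B X Y dA dB) :
    A → X → Matrix (Fin dB) (Fin dB) ℂ :=
  fun a x => traceLeft ((S.N a x ⊗ₖ (1 : Matrix (Fin dB) (Fin dB) ℂ)) * S.ρ)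

/-- The steering assemblage `M ∘ ρ` on Alice's system: `Tr_B[(1 ⊗ M_{b|y}) ρ]`. -/
def Scenario.steerA {A B X Y : Type} {dA dB : ℕ} (S : Scenario A B X Y dA dB) :
    B → Y → Matrix (Fin dA) (Fin dA) ℂ :=
  fun b y => traceRight (((1 : Matrix (Fin dA) (Fin dA) ℂ) ⊗ₖ S.M b y) * S.ρ)

/-- All linear identities `∑_{a,x} α_{a,x} E_{a|x} = 0`. -/
def allIdentities {A X : Type} [Fintype A] [Fintype X] {d : ℕ}
    (E : A → X → Matrix (Fin d) (Fin d) ℂ) : Set (A → X → ℝ) :=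
  {α | ∑ a, ∑ x, α a x • E a x = 0}

/-- The trivial identities: those that arise (as linear combinations) from
`∑_a E_{a|x} = ∑_a E_{a|x'}`. -/
def trivialIdentities (A X : Type) [DecidableEq X] : Set (A → X → ℝ) :=
  (Submodule.span ℝ
    {α : A → X → ℝ | ∃ x x' : X,
      α = fun _ z => (if z = x then 1 else 0) - (if z = x' then 1 else 0)} : Set (A → X → ℝ))

/-- A coefficient vector together with the family of processes (`N`, `M`, `N ∘ ρ` or `M ∘ ρ`)
on which it is an identity. -/
inductive OpIdentity (A B X Y : Type) : Type
  | onN (α : A → X → ℝ)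
  | onM (β : B → Y → ℝ)
  | onNρ (α : A → X → ℝ)
  | onMρ (β : B → Y → ℝ)

/-- Which identities are imposed on a family: `a` all, `t` only the trivial ones. -/
inductive Kind : Type
  | a
  | t

def identities {A X : Type} [Fintype A] [Fintype X] [DecidableEq X] {d : ℕ} :
    Kind → (A → X → Matrix (Fin d) (Fin d) ℂ) → Set (A → X → ℝ)
  | .a, E => allIdentities E
  | .t, _ => trivialIdentities A X

/-- `O_{ijuv}(S) = O_i(N) ∪ O_j(M) ∪ O_u(N ∘ ρ) ∪ O_v(M ∘ ρ)`. -/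
def Scenario.O {A B X Y : Type} [Fintype A] [Fintype B] [Fintype X] [Fintype Y]
    [DecidableEq X] [DecidableEq Y] {dA dB : ℕ} (S : Scenario A B X Y dA dB)
    (i j u v : Kind) : Set (OpIdentity A B X Y) :=
  OpIdentity.onN '' identities i S.N ∪ OpIdentity.onM '' identities j S.M ∪
    OpIdentity.onNρ '' identities u S.steerB ∪ OpIdentity.onMρ '' identities v S.steerA

/-! ## Noncontextual ontological models -/

/-- A local (diagram-preserving) ontological model with finite ontic state spaces `Fin k`, `Fin l`:
a joint distribution `μ` of the ontic states and response functions
`ξ a x lam = p(a|x,λ_A)` and `η b y lam = p(b|y,λ_B)`. -/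
structure OntModel (A B X Y : Type) [Fintype A] [Fintype B] (k l : ℕ) where
  μ : Fin k → Fin l → ℝ
  ξ : A → X → Fin k → ℝ
  η : B → Y → Fin l → ℝ
  μ_nonneg : ∀ s t, 0 ≤ μ s t
  μ_sum : ∑ s, ∑ t, μ s t = 1
  ξ_nonneg : ∀ a x s, 0 ≤ ξ a x s
  ξ_sum : ∀ x s, ∑ a, ξ a x s = 1
  η_nonneg : ∀ b y t, 0 ≤ η b y t
  η_sum : ∀ y t, ∑ b, η b y t = 1

/-- The statistics `p(ab|xy) = ∑ p(λ_A λ_B) p(a|x,λ_A) p(b|y,λ_B)` of the model. -/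
def OntModel.statistics {A B X Y : Type} [Fintype A] [Fintype B] {k l : ℕ}
    (m : OntModel A B X Y k l) : Stat A B X Y :=
  fun a b x y => ∑ s, ∑ t, m.μ s t * m.ξ a x s * m.η b y t

/-- The model satisfies the ontological counterpart of an operational identity. -/
def OntModel.Respects {A B X Y : Type} [Fintype A] [Fintype B] [Fintype X] [Fintype Y] {k l : ℕ}
    (m : OntModel A B X Y k l) : OpIdentity A B X Y → Prop
  | .onN α => ∀ s, ∑ a, ∑ x, α a x * m.ξ a x s = 0
  | .onM β => ∀ t, ∑ b, ∑ y, β b y * m.η b y t = 0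
  | .onNρ α => ∀ t, ∑ a, ∑ x, α a x * (∑ s, m.ξ a x s * m.μ s t) = 0
  | .onMρ β => ∀ s, ∑ b, ∑ y, β b y * (∑ t, m.η b y t * m.μ s t) = 0

/-- `p` is realizable by a noncontextual ontological model, relative to a set `O` of operational
identities. -/
def NCOMRealizable {A B X Y : Type} [Fintype A] [Fintype B] [Fintype X] [Fintype Y]
    (O : Set (OpIdentity A B X Y)) (p : Stat A B X Y) : Prop :=
  ∃ (k l : ℕ) (m : OntModel A B X Y k l), m.statistics = p ∧ ∀ o ∈ O, m.Respects o

/-- `NC_{ijuv}`, the set of all statistics that are realizable relative to `O_{ijuv}`. -/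
def Scenario.NC {A B X Y : Type} [Fintype A] [Fintype B] [Fintype X] [Fintype Y]
    [DecidableEq X] [DecidableEq Y] {dA dB : ℕ} (S : Scenario A B X Y dA dB)
    (i j u v : Kind) : Set (Stat A B X Y) :=
  {p | NCOMRealizable (S.O i j u v) p}

/-! ## Polytopes and facets -/

def IsPolytope {V : Type} [AddCommGroup V] [Module ℝ V] (P : Set V) : Prop :=
  ∃ F : Set V, F.Finite ∧ P = convexHull ℝ F

/-- The dimension of (the affine hull of) a set. -/
def affDim {V : Type} [AddCommGroup V] [Module ℝ V] (P : Set V) : ℕ :=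
  Module.finrank ℝ (vectorSpan ℝ P)

/-- `f ≥ 0` is a linear inequality that is valid on `P`, and the face `{p ∈ P | f p = 0}` is a
facet, i.e. nonempty and of dimension one less than `P`. -/
def IsFacetDefining {V : Type} [AddCommGroup V] [Module ℝ V] (P : Set V) (f : V → ℝ) : Prop :=
  IsLinearMap ℝ f ∧ (∀ p ∈ P, 0 ≤ f p) ∧ {p ∈ P | f p = 0}.Nonempty ∧
    affDim {p ∈ P | f p = 0} + 1 = affDim P

/-! ## The (icosahedron, dodecahedron) scenario -/

/-- The linear identities that hold between labelled points in an affine space, placed in an affine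
hyperplane off the origin: `∑ α_{a,x} = 0` and `∑ α_{a,x} t_{a,x} = 0`. -/
def geometricIdentities {A X : Type} [Fintype A] [Fintype X] (t : A → X → Fin 3 → ℝ) :
    Set (A → X → ℝ) :=
  {α | ∑ a, ∑ x, α a x = 0 ∧ ∑ a, ∑ x, α a x • t a x = 0}

/-- One vertex out of each antipodal pair of vertices of a regular icosahedron. -/
def icosaVec : Fin 6 → Fin 3 → ℝ :=
  ![![0, 1, φ], ![0, 1, -φ], ![1, φ, 0], ![1, -φ, 0], ![φ, 0, 1], ![φ, 0, -1]]

/-- One vertex out of each antipodal pair of vertices of a regular dodecahedron. -/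
def dodecaVec : Fin 10 → Fin 3 → ℝ :=
  ![![-1, -1, -1], ![-φ, 1 / φ, 0], ![-φ, -(1 / φ), 0], ![-1, -1, 1], ![0, -φ, 1 / φ],
    ![1, -1, -1], ![0, -φ, -(1 / φ)], ![-1, 1, -1], ![-(1 / φ), 0, -φ], ![1 / φ, 0, -φ]]

/-- The labelled vertices `t_{a,x} = (-1)^a v_x`. -/
def antipodal {X : Type} (v : X → Fin 3 → ℝ) : Fin 2 → X → Fin 3 → ℝ :=
  fun a x => ((-1 : ℝ) ^ (a : ℕ)) • v x

/-- A scenario with the intrinsic geometry of an icosahedron on Alice's side and a dodecahedron on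
Bob's side: the measurements satisfy exactly the identities of the labelled vertices. -/
def Scenario.IsIcosaDodeca {dA dB : ℕ} (S : Scenario (Fin 2) (Fin 2) (Fin 6) (Fin 10) dA dB) :
    Prop :=
  allIdentities S.N = geometricIdentities (antipodal icosaVec) ∧
    allIdentities S.M = geometricIdentities (antipodal dodecaVec)

/-- The left-hand side of the golden-ratio inequality. -/
def goldenI (p : Stat (Fin 2) (Fin 2) (Fin 6) (Fin 10)) : ℝ :=
  p 0 0 0 0 + p 0 0 0 1 - (φ + 1) * p 0 0 0 2 + 1 / φ * p 0 0 0 3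
    + 1 / φ * p 0 0 1 0 + 1 / φ * p 0 0 1 1 - 2 * p 0 0 1 2 + p 0 0 1 3
    - p 0 0 2 0 - 1 / φ * p 0 0 2 1 + (φ + 1) * p 0 0 2 2 - p 0 0 2 3
    - 1 / φ ^ 2 * p 1 0 1 1 + 1 / φ * p 1 0 1 2

/-! ## Qubit measurements and isotropic states -/

def pauli : Fin 3 → Matrix (Fin 2) (Fin 2) ℂ :=
  ![!![0, 1; 1, 0], !![0, -Complex.I; Complex.I, 0], !![1, 0; 0, -1]]

/-- The effects `(1 + (-1)^a v_x · σ) / 2`. -/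
def blochMeas {X : Type} (v : X → Fin 3 → ℝ) : Fin 2 → X → Matrix (Fin 2) (Fin 2) ℂ :=
  fun a x => (1 / 2 : ℝ) • (1 + ((-1 : ℝ) ^ (a : ℕ)) • ∑ i, v x i • pauli i)

/-- `|Φ⁺⟩ = (|00⟩ + |11⟩) / √2`. -/
def phiPlus : Fin 2 × Fin 2 → ℂ :=
  fun k => if k.1 = k.2 then ((1 / √2 : ℝ) : ℂ) else 0

/-- `p |Φ⁺⟩⟨Φ⁺| + (1 - p) 1/4`. -/
def isotropic (p : ℝ) : Matrix (Fin 2 × Fin 2) (Fin 2 × Fin 2) ℂ :=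
  p • Matrix.vecMulVec phiPlus (star phiPlus) + (1 - p) • (1 / 4 : ℝ) • 1

/-- Icosahedral measurements for Alice and dodecahedral measurements for Bob, with unit Bloch
vectors, on an isotropic state. -/
def qubitScenario (p : ℝ) : Scenario (Fin 2) (Fin 2) (Fin 6) (Fin 10) 2 2 where
  N := blochMeas fun x => (1 / √(1 + φ ^ 2)) • icosaVec x
  M := blochMeas fun y => (1 / √3) • dodecaVec y
  ρ := isotropic p

end Bell

end

open scoped Kronecker ComplexOrder goldenRatio

namespace Bell

/-! ### Noncontextual statistics as mixtures of product responses -/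

section General

variable {A B X Y : Type}

/-! When only trivial identities are imposed on the assemblages, the shared distribution `μ` is
unconstrained, so the noncontextual statistics are the convex hull of products of local response
functions. Each response set is a polytope, and hulls of bilinear images of polytopes are polytopes.

The identities of labelled vertices `±v_x` force a response function to be affine on the solid they
span: it is `(1 ± v_x · u) / 2` with `u` in the polar body. Alice's `u` therefore ranges over a
dodecahedron and Bob's `w` over an icosahedron. On a product, `goldenI` loses all marginal terms and
becomes `(φ - 1) / 2` times `(2 - φ) - (u₀w₀ - u₁w₁ + u₂w₂)`. Validity is thus the statement that
this bilinear form is at most `2 - φ` on dodecahedron × icosahedron (`icosa_dodeca_bound`), proved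
by splitting an octant of the icosahedron into cones over its faces.

Equality holds at the vertices of a cube inscribed in the dodecahedron, each paired with three
vertices of the icosahedron. These 24 pairs determine a biaffine form up to its constant term
(`biaffine_eq_zero`), so the face is a facet.

Strictness comes from linear dependences among the `v_x`: each gives a nontrivial identity which the
marginals must obey and which some unconstrained response breaks.

For the qubit scenario the correlation matrix is `diag(1, -1, 1)` scaled by `p / (√(1 + φ²) √3)`.
The form then takes the value `√3 p / √(1 + φ²)`, which exceeds `2 - φ = 1 / φ²` exactly above the
threshold. -/

/-- The product statistics `p(ab|xy) = ξ(a|x) η(b|y)`, as a bilinear map. -/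
noncomputable def productStat : (A → X → ℝ) →ₗ[ℝ] (B → Y → ℝ) →ₗ[ℝ] Stat A B X Y :=
  LinearMap.mk₂ ℝ (fun ξ η a b x y => ξ a x * η b y)
    (fun _ _ _ => by ext; simp [add_mul]) (fun _ _ _ => by ext; simp [mul_assoc])
    (fun _ _ _ => by ext; simp [mul_add]) (fun _ _ _ => by ext; simp [mul_left_comm])

@[simp]
theorem productStat_apply (ξ : A → X → ℝ) (η : B → Y → ℝ) (a : A) (b : B) (x : X) (y : Y) :
    productStat ξ η a b x y = ξ a x * η b y := rfl

/-- The response functions that satisfy a set of linear identities. -/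
def responses [Fintype A] [Fintype X] (I : Set (A → X → ℝ)) : Set (A → X → ℝ) :=
  {ξ | (∀ a x, 0 ≤ ξ a x) ∧ (∀ x, ∑ a, ξ a x = 1) ∧ ∀ α ∈ I, ∑ a, ∑ x, α a x * ξ a x = 0}

theorem responses_anti [Fintype A] [Fintype X] {I J : Set (A → X → ℝ)} (h : I ⊆ J) :
    responses J ⊆ responses I :=
  fun _ hξ => ⟨hξ.1, hξ.2.1, fun α hα => hξ.2.2 α (h hα)⟩

theorem exists_of_mem_trivialIdentities [DecidableEq X] [Fintype X] {α : A → X → ℝ}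
    (hα : α ∈ trivialIdentities A X) : ∃ c : X → ℝ, ∑ x, c x = 0 ∧ ∀ a x, α a x = c x := by
  refine Submodule.span_induction (p := fun α _ => ∃ c : X → ℝ, ∑ x, c x = 0 ∧ ∀ a x, α a x = c x)
    ?_ ?_ ?_ ?_ hα
  · rintro _ ⟨x, x', rfl⟩
    exact ⟨fun z => (if z = x then 1 else 0) - (if z = x' then 1 else 0), by simp, fun _ _ => rfl⟩
  · exact ⟨0, by simp, by simp⟩
  · rintro α β _ _ ⟨c, hc, hα⟩ ⟨d, hd, hβ⟩
    exact ⟨c + d, by simp [Finset.sum_add_distrib, hc, hd], by simp [hα, hβ]⟩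
  · rintro r α _ ⟨c, hc, hα⟩
    exact ⟨r • c, by simp [← Finset.mul_sum, hc], by simp [hα]⟩

theorem sum_mul_eq_zero_of_mem_trivialIdentities [Fintype A] [Fintype X] [DecidableEq X]
    {α ξ : A → X → ℝ} (hα : α ∈ trivialIdentities A X) {r : ℝ} (hξ : ∀ x, ∑ a, ξ a x = r) :
    ∑ a, ∑ x, α a x * ξ a x = 0 := by
  obtain ⟨c, hc, h⟩ := exists_of_mem_trivialIdentities hα
  rw [Finset.sum_comm]
  simp [h, ← Finset.mul_sum, hξ, ← Finset.sum_mul, hc]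

theorem mem_responses_trivialIdentities [Fintype A] [Fintype X] [DecidableEq X] {ξ : A → X → ℝ} :
    ξ ∈ responses (trivialIdentities A X) ↔ (∀ a x, 0 ≤ ξ a x) ∧ ∀ x, ∑ a, ξ a x = 1 :=
  ⟨fun h => ⟨h.1, h.2.1⟩,
    fun h => ⟨h.1, h.2, fun _ hα => sum_mul_eq_zero_of_mem_trivialIdentities hα h.2⟩⟩

variable [Fintype A] [Fintype B] [Fintype X] [Fintype Y] [DecidableEq X] [DecidableEq Y]

/-- If only trivial identities are imposed on the assemblages, the noncontextual statistics are the
mixtures of products of response functions that satisfy the identities of the measurements. -/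
theorem Scenario.NC_tt_eq_convexHull {dA dB : ℕ} (S : Scenario A B X Y dA dB) (i j : Kind) :
    S.NC i j .t .t = convexHull ℝ (Set.image2 (fun ξ η => productStat ξ η)
      (responses (identities i S.N)) (responses (identities j S.M))) := by
  ext p
  constructor
  · rintro ⟨k, l, m, rfl, hm⟩
    have hstat : m.statistics = ∑ s : Fin k × Fin l, m.μ s.1 s.2 •
        productStat (fun a x => m.ξ a x s.1) (fun b y => m.η b y s.2) := by
      ext a b x y
      simp [OntModel.statistics, Finset.sum_apply, Fintype.sum_prod_type, mul_assoc]
    rw [hstat]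
    refine (convex_convexHull ℝ _).sum_mem (fun s _ => m.μ_nonneg _ _) ?_ fun s _ => ?_
    · rw [Fintype.sum_prod_type]; exact m.μ_sum
    · refine subset_convexHull ℝ _ ⟨_, ⟨fun a x => m.ξ_nonneg a x s.1, fun x => m.ξ_sum x s.1,
        fun α hα => ?_⟩, _, ⟨fun b y => m.η_nonneg b y s.2, fun y => m.η_sum y s.2,
        fun β hβ => ?_⟩, rfl⟩
      · exact hm (.onN α) (by simp [Scenario.O, hα]) s.1
      · exact hm (.onM β) (by simp [Scenario.O, hβ]) s.2
  · intro hp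
    obtain ⟨ι, _, w, z, hw₀, hw₁, hz, rfl⟩ := mem_convexHull_iff_exists_fintype.1 hp
    choose ξ hξ η hη hz using hz
    let e := Fintype.equivFin ι
    -- Perfectly correlated ontic states: both parties receive the index of the convex combination.
    -- The assemblage response at a state then sums over outcomes to its weight for every setting,
    -- which is all that trivial identities require.
    let m : OntModel A B X Y (Fintype.card ι) (Fintype.card ι) :=
      { μ := fun s t => if s = t then w (e.symm s) else 0
        ξ := fun a x s => ξ (e.symm s) a x
        η := fun b y s => η (e.symm s) b y
        μ_nonneg := fun s t => by split_ifs <;> simp [hw₀]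
        μ_sum := by simpa using (e.symm.sum_comp w).trans hw₁
        ξ_nonneg := fun a x s => (hξ _).1 a x
        ξ_sum := fun x s => (hξ _).2.1 x
        η_nonneg := fun b y s => (hη _).1 b y
        η_sum := fun y s => (hη _).2.1 y }
    refine ⟨_, _, m, ?_, ?_⟩
    · ext a b x y
      simp only [OntModel.statistics, m, ite_mul, zero_mul, Finset.sum_ite_eq, Finset.mem_univ,
        if_true, ← hz, Finset.sum_apply, Pi.smul_apply, productStat_apply, smul_eq_mul]
      rw [e.symm.sum_comp fun i => w i * ξ i a x * η i b y]
      simp [mul_assoc]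
    · rintro (α | β | α | β) ho
      · intro s
        exact (hξ _).2.2 α (by simpa [Scenario.O] using ho)
      · intro s
        exact (hη _).2.2 β (by simpa [Scenario.O] using ho)
      · intro t
        refine sum_mul_eq_zero_of_mem_trivialIdentities (r := w (e.symm t))
          (by simpa [Scenario.O, identities] using ho) fun x => ?_
        simp [m, ← Finset.sum_mul, (hξ _).2.1]
      · intro s
        refine sum_mul_eq_zero_of_mem_trivialIdentities (r := w (e.symm s))
          (by simpa [Scenario.O, identities] using ho) fun y => ?_
        simp [m, ← Finset.sum_mul, (hη _).2.1]

end General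

/-! ### Polytopality -/

section Polytope

theorem LinearMap.convexHull_image2 {E F G : Type*} [AddCommGroup E] [Module ℝ E]
    [AddCommGroup F] [Module ℝ F] [AddCommGroup G] [Module ℝ G] (T : E →ₗ[ℝ] F →ₗ[ℝ] G)
    (s : Set E) (t : Set F) :
    convexHull ℝ (Set.image2 (fun x y => T x y) (convexHull ℝ s) (convexHull ℝ t)) =
      convexHull ℝ (Set.image2 (fun x y => T x y) s t) := by
  refine (convexHull_min ?_ (convex_convexHull ℝ _)).antisymm (convexHull_mono
    (Set.image2_subset (subset_convexHull ℝ s) (subset_convexHull ℝ t)))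
  rintro _ ⟨x, hx, y, hy, rfl⟩
  have h1 : ∀ x ∈ s, T x y ∈ convexHull ℝ (Set.image2 (fun x y => T x y) s t) := fun x hx =>
    convexHull_min (t := T x ⁻¹' convexHull ℝ (Set.image2 (fun x y => T x y) s t))
      (fun y hy => subset_convexHull ℝ _ ⟨x, hx, y, hy, rfl⟩)
      ((convex_convexHull ℝ _).linear_preimage _) hy
  exact convexHull_min (t := T.flip y ⁻¹' convexHull ℝ (Set.image2 (fun x y => T x y) s t))
    (fun x hx => h1 x hx) ((convex_convexHull ℝ _).linear_preimage _) hx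

variable {A X : Type} [Fintype A] [Fintype X]

theorem convex_responses (I : Set (A → X → ℝ)) : Convex ℝ (responses I) := by
  rintro ξ ⟨h1, h2, h3⟩ η ⟨k1, k2, k3⟩ r s hr hs hrs
  refine ⟨fun a x => add_nonneg (mul_nonneg hr (h1 a x)) (mul_nonneg hs (k1 a x)), fun x => ?_,
    fun α hα => ?_⟩
  · simp [Finset.sum_add_distrib, ← Finset.mul_sum, h2, k2, hrs]
  · simp [mul_add, Finset.sum_add_distrib, mul_left_comm _ r, mul_left_comm _ s, ← Finset.mul_sum,
      h3 α hα, k3 α hα]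

theorem isCompact_responses (I : Set (A → X → ℝ)) : IsCompact (responses I) := by
  have hK : IsCompact (Set.univ.pi fun _ : A => Set.univ.pi fun _ : X => Set.Icc (0 : ℝ) 1) :=
    isCompact_univ_pi fun _ => isCompact_univ_pi fun _ => isCompact_Icc
  refine hK.of_isClosed_subset ?_ fun ξ hξ a _ x _ => ⟨hξ.1 a x, ?_⟩
  · simp only [responses, Set.ofPred_and, Set.ofPred_forall]
    refine .inter ?_ (.inter ?_ ?_)
    · exact isClosed_iInter fun a => isClosed_iInter fun x => isClosed_le (by fun_prop) (by fun_prop)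
    · exact isClosed_iInter fun x => isClosed_eq (by fun_prop) (by fun_prop)
    · exact isClosed_iInter fun α => isClosed_iInter fun _ => isClosed_eq (by fun_prop) (by fun_prop)
  · rw [← hξ.2.1 x]
    exact Finset.single_le_sum (f := fun a => ξ a x) (fun a _ => hξ.1 a x) (Finset.mem_univ a)

/-- An extreme response function is determined by its support. -/
theorem injOn_support_extremePoints_responses (I : Set (A → X → ℝ)) :
    Set.InjOn (fun (ξ : A → X → ℝ) => {q : A × X | ξ q.1 q.2 = 0})
      (Set.extremePoints ℝ (responses I)) := by
  intro ξ hξ η hη h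
  obtain ⟨⟨k1, k2, k3⟩, -⟩ := hη
  obtain ⟨⟨h1, h2, h3⟩, hext⟩ := mem_extremePoints.1 hξ
  have hsupp : ∀ a x, ξ a x = 0 → η a x = 0 := fun a x h0 =>
    (Set.ext_iff.1 h (a, x)).1 h0
  obtain ⟨ε, hε, hε'⟩ : ∃ ε : ℝ, 0 < ε ∧ ∀ q : A × X, ε * η q.1 q.2 ≤ ξ q.1 q.2 := by
    have : ∀ q : A × X, ∀ᶠ ε in nhdsWithin (0 : ℝ) (Set.Ioi 0), ε * η q.1 q.2 ≤ ξ q.1 q.2 := by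
      intro q
      rcases (h1 q.1 q.2).eq_or_lt with h0 | h0
      · simp [hsupp _ _ h0.symm, ← h0]
      · have : Filter.Tendsto (fun ε : ℝ => ε * η q.1 q.2) (nhdsWithin 0 (Set.Ioi 0))
            (nhds (0 * η q.1 q.2)) :=
          (Filter.Tendsto.mul_const _ Filter.tendsto_id).mono_left nhdsWithin_le_nhds
        exact (this.eventually_lt_const (by simpa using h0)).mono fun _ => le_of_lt
    obtain ⟨ε, h, h'⟩ := ((Filter.eventually_all.2 this).and self_mem_nhdsWithin).exists
    exact ⟨ε, h', h⟩
  -- Equal supports leave room to move from `ξ` a little away from `η`. This puts `ξ` strictly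
  -- inside a segment ending at `η`, so extremality gives `ξ = η`.
  have hmem : ξ + ε • (ξ - η) ∈ responses I := by
    refine ⟨fun a x => ?_, fun x => ?_, fun α hα => ?_⟩
    · have := hε' (a, x)
      have := mul_nonneg hε.le (h1 a x)
      simp only [Pi.add_apply, Pi.smul_apply, Pi.sub_apply, smul_eq_mul]
      linarith
    · simp [Finset.sum_add_distrib, ← Finset.mul_sum, h2, k2]
    · simp [mul_add, mul_sub, Finset.sum_add_distrib, mul_left_comm _ ε, ← Finset.mul_sum,
        h3 α hα, k3 α hα]
  refine (hext _ hmem η ⟨k1, k2, k3⟩ ⟨1 / (1 + ε), ε / (1 + ε), by positivity, by positivity,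
    by field_simp, ?_⟩).2.symm
  ext a x
  simp only [Pi.add_apply, Pi.smul_apply, Pi.sub_apply, smul_eq_mul]
  field_simp
  ring

/-- There are finitely many supports, hence finitely many extreme points, and Krein–Milman recovers
the compact convex set from them. -/
theorem isPolytope_responses (I : Set (A → X → ℝ)) : IsPolytope (responses I) := by
  have hfin : (Set.extremePoints ℝ (responses I)).Finite :=
    Set.Finite.of_injOn (Set.mapsTo_univ _ _) (injOn_support_extremePoints_responses I)
      Set.finite_univ
  refine ⟨_, hfin, ?_⟩
  rw [← (hfin.isClosed_convexHull ℝ).closure_eq,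
    closure_convexHull_extremePoints (isCompact_responses I) (convex_responses I)]

theorem Scenario.isPolytope_NC_tt {B Y : Type} [Fintype B] [Fintype Y] [DecidableEq X]
    [DecidableEq Y] {dA dB : ℕ} (S : Scenario A B X Y dA dB) (i j : Kind) :
    IsPolytope (S.NC i j .t .t) := by
  obtain ⟨F, hF, hFN⟩ := isPolytope_responses (identities i S.N)
  obtain ⟨G, hG, hGM⟩ := isPolytope_responses (identities j S.M)
  refine ⟨_, hF.image2 (fun ξ η => productStat ξ η) hG, ?_⟩
  rw [S.NC_tt_eq_convexHull, hFN, hGM, LinearMap.convexHull_image2]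

end Polytope

/-! ### Polar solids and the bilinear bound -/

section Geometry

variable {X : Type}

/-- The response function `p(a|x) = (1 + (-1)^a v_x · u) / 2`. -/
noncomputable def affineResponse (v : X → Fin 3 → ℝ) (u : Fin 3 → ℝ) : Fin 2 → X → ℝ :=
  fun a x => (1 + (-1) ^ (a : ℕ) * (v x ⬝ᵥ u)) / 2

theorem affineResponse_nonneg_iff {v : X → Fin 3 → ℝ} {u : Fin 3 → ℝ} :
    (∀ a x, 0 ≤ affineResponse v u a x) ↔ ∀ x, |v x ⬝ᵥ u| ≤ 1 := by
  simp only [affineResponse, Fin.forall_fin_two, abs_le, ← forall_and]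
  refine forall_congr' fun x => ?_
  simp only [Fin.val_zero, pow_zero, Fin.val_one, pow_one]
  constructor <;> rintro ⟨h1, h2⟩ <;> constructor <;> linarith

/-- A functional vanishing on the common kernel of finitely many functionals lies in their span.
Here the span is that of the total sum and the three coordinates; normalization fixes the constant
part and positivity says that `u` is in the polar body. -/
theorem mem_responses_geometricIdentities [Fintype X] [DecidableEq X] [Nonempty X]
    {v : X → Fin 3 → ℝ} {ξ : Fin 2 → X → ℝ} :
    ξ ∈ responses (geometricIdentities (antipodal v)) ↔
      ∃ u, (∀ x, |v x ⬝ᵥ u| ≤ 1) ∧ ξ = affineResponse v u := by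
  constructor
  · rintro ⟨h1, h2, h3⟩
    let pair : (Fin 2 → X → ℝ) → ((Fin 2 → X → ℝ) →ₗ[ℝ] ℝ) := fun ξ =>
      { toFun := fun α => ∑ a, ∑ x, α a x * ξ a x
        map_add' := fun α β => by simp only [Pi.add_apply, add_mul, Finset.sum_add_distrib]
        map_smul' := fun r α => by
          simp only [Pi.smul_apply, smul_eq_mul, mul_assoc, Finset.mul_sum, RingHom.id_apply] }
    have hpair : ∀ ξ α, pair ξ α = ∑ a, ∑ x, α a x * ξ a x := fun _ _ => rfl
    -- `none` stands for the condition `∑ α = 0`, `some i` for the `i`-th vector coordinate.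
    let L : Option (Fin 3) → ((Fin 2 → X → ℝ) →ₗ[ℝ] ℝ) := fun o =>
      o.elim (pair fun _ _ => 1) fun i => pair fun a x => antipodal v a x i
    have hmem : pair ξ ∈ Submodule.span ℝ (Set.range L) := by
      refine mem_span_of_iInf_ker_le_ker fun α hα => ?_
      simp only [Submodule.mem_iInf, LinearMap.mem_ker] at hα ⊢
      refine h3 α ⟨by simpa [L, hpair] using hα none, ?_⟩
      ext i
      simpa [L, hpair, Finset.sum_apply] using hα (some i)
    obtain ⟨c, hc⟩ := (Submodule.mem_span_range_iff_exists_fun ℝ).1 hmem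
    have hξ : ∀ a x, ξ a x = c none + (-1) ^ (a : ℕ) * ∑ i, v x i * c (some i) := by
      intro a x
      have := LinearMap.congr_fun hc (Pi.single a (Pi.single x 1))
      have hs : ∀ ζ : Fin 2 → X → ℝ, pair ζ (Pi.single a (Pi.single x 1)) = ζ a x := by
        intro ζ
        rw [hpair, Finset.sum_eq_single a (by intro b _ hb; simp [hb]) (by simp),
          Finset.sum_eq_single x (by intro b _ hb; simp [hb]) (by simp)]
        simp
      simp only [Fintype.sum_option, L, Option.elim, LinearMap.add_apply, LinearMap.sum_apply,
        LinearMap.smul_apply, hs, smul_eq_mul, antipodal, Pi.smul_apply] at this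
      rw [← this, Finset.mul_sum, mul_one]
      congr 1
      exact Finset.sum_congr rfl fun i _ => by ring
    have hhalf : c none = 1 / 2 := by
      have := h2 (Classical.arbitrary X)
      simp only [Fin.sum_univ_two, hξ, Fin.val_zero, pow_zero, Fin.val_one, pow_one] at this
      linarith
    have hξ' : ξ = affineResponse v fun i => 2 * c (some i) := by
      ext a x
      rw [hξ, hhalf, affineResponse, dotProduct]
      simp only [mul_left_comm _ (2 : ℝ), ← Finset.mul_sum]
      ring
    refine ⟨_, ?_, hξ'⟩
    rw [← affineResponse_nonneg_iff, ← hξ']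
    exact h1
  · rintro ⟨u, hu, rfl⟩
    refine ⟨affineResponse_nonneg_iff.2 hu, fun x => ?_, ?_⟩
    · simp only [affineResponse, Fin.sum_univ_two, Fin.val_zero, pow_zero, Fin.val_one, pow_one]
      ring
    · rintro α ⟨h1, h2⟩
      have h3 : ∑ a, ∑ x, α a x * ((-1) ^ (a : ℕ) * (v x ⬝ᵥ u)) = 0 := by
        have := congrArg (fun t : Fin 3 → ℝ => t ⬝ᵥ u) h2
        simpa [sum_dotProduct, antipodal, smul_dotProduct] using this
      have : ∑ a, ∑ x, α a x * affineResponse v u a x =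
          ((∑ a, ∑ x, α a x) + ∑ a, ∑ x, α a x * ((-1) ^ (a : ℕ) * (v x ⬝ᵥ u))) / 2 := by
        simp only [← Finset.sum_add_distrib, Finset.sum_div]
        exact Finset.sum_congr rfl fun a _ => Finset.sum_congr rfl fun x _ => by
          rw [affineResponse]; ring
      rw [this, h1, h3]
      simp

theorem abs_add_abs_le_iff {a b c : ℝ} : |a| + |b| ≤ c ↔ |a + b| ≤ c ∧ |a - b| ≤ c := by
  refine ⟨fun h => ⟨(abs_add_le a b).trans h, (abs_sub a b).trans h⟩, fun ⟨h1, h2⟩ => ?_⟩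
  rw [abs_le] at h1 h2
  rcases abs_cases a with ⟨h, -⟩ | ⟨h, -⟩ <;> rcases abs_cases b with ⟨k, -⟩ | ⟨k, -⟩ <;>
    rw [h, k] <;> linarith

theorem one_div_goldenRatio : 1 / φ = φ - 1 := by
  rw [one_div, Real.inv_goldenRatio, ← Real.one_sub_goldenRatio]
  ring

/-- The vertex set is invariant under coordinate sign changes, so polar membership depends only on
absolute values and the bound can be proved in the positive octant. -/
theorem forall_icosaVec_dotProduct_le_iff {u : Fin 3 → ℝ} :
    (∀ x, |icosaVec x ⬝ᵥ u| ≤ 1) ↔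
      |u 1| + φ * |u 2| ≤ 1 ∧ |u 0| + φ * |u 1| ≤ 1 ∧ φ * |u 0| + |u 2| ≤ 1 := by
  have h (t : ℝ) : φ * |t| = |φ * t| := by rw [abs_mul, abs_of_pos Real.goldenRatio_pos]
  simp only [h, abs_add_abs_le_iff, Fin.forall_fin_succ, IsEmpty.forall_iff]
  simp [icosaVec, dotProduct, Fin.sum_univ_three, sub_eq_add_neg, and_assoc]

theorem forall_dodecaVec_dotProduct_le_iff {w : Fin 3 → ℝ} :
    (∀ y, |dodecaVec y ⬝ᵥ w| ≤ 1) ↔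
      |w 0| + |w 1| + |w 2| ≤ 1 ∧ φ * |w 0| + (φ - 1) * |w 1| ≤ 1 ∧
        φ * |w 1| + (φ - 1) * |w 2| ≤ 1 ∧ (φ - 1) * |w 0| + φ * |w 2| ≤ 1 := by
  have h (t : ℝ) : φ * |t| = |φ * t| := by rw [abs_mul, abs_of_pos Real.goldenRatio_pos]
  have h' (t : ℝ) : (φ - 1) * |t| = |(φ - 1) * t| := by
    rw [abs_mul, abs_of_pos (sub_pos.2 Real.one_lt_goldenRatio)]
  have h3 (a b c : ℝ) : |a| + |b| + |c| ≤ 1 ↔ |a + b + c| ≤ 1 ∧ |a - b + c| ≤ 1 ∧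
      |a + b - c| ≤ 1 ∧ |a - b - c| ≤ 1 := by
    constructor
    · intro h
      rw [← abs_neg b, ← abs_neg c] at h
      simp only [sub_eq_add_neg]
      refine ⟨?_, ?_, ?_, ?_⟩ <;> refine (abs_add_three _ _ _).trans ?_ <;> simpa using h
    · rintro ⟨h1, h2, h3, h4⟩
      rw [abs_le] at h1 h2 h3 h4
      rcases abs_cases a with ⟨h, -⟩ | ⟨h, -⟩ <;> rcases abs_cases b with ⟨k, -⟩ | ⟨k, -⟩ <;>
        rcases abs_cases c with ⟨l, -⟩ | ⟨l, -⟩ <;> rw [h, k, l] <;> linarith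
  simp only [h, h', h3, abs_add_abs_le_iff, Fin.forall_fin_succ, IsEmpty.forall_iff, dodecaVec,
    dotProduct, Fin.sum_univ_three, one_div_goldenRatio]
  simp only [abs_le, Matrix.cons_val_zero, Matrix.cons_val_succ, Matrix.cons_val, and_assoc, and_true]
  constructor <;>
    rintro ⟨h1, h2, h3, h4, h5, h6, h7, h8, h9, h10, h11, h12, h13, h14, h15, h16, h17, h18, h19,
      h20⟩ <;>
    refine ⟨?_, ?_, ?_, ?_, ?_, ?_, ?_, ?_, ?_, ?_, ?_, ?_, ?_, ?_, ?_, ?_, ?_, ?_, ?_, ?_⟩ <;>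
    linarith

/-- The case of a point `b` in the cone over the half-face of the icosahedron at the first
coordinate axis. -/
theorem sum_mul_le_of_mem_axis_cone {a₀ a₁ a₂ b₀ b₁ b₂ : ℝ} (ha₂ : 0 ≤ a₂) (hb₁ : 0 ≤ b₁)
    (h01 : a₀ + φ * a₁ ≤ 1) (h20 : φ * a₀ + a₂ ≤ 1) (hb : φ * b₀ + (φ - 1) * b₁ ≤ 1)
    (hb₂ : 0 ≤ b₂) (hcone : b₁ + (φ + 1) * b₂ ≤ φ * b₀) :
    a₀ * b₀ + a₁ * b₁ + a₂ * b₂ ≤ 2 - φ := by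
  have hφ := Real.goldenRatio_sq
  have hφ1 := Real.one_lt_goldenRatio
  have hφ2 := Real.goldenRatio_lt_two
  have hc : 0 ≤ (φ - 1) * b₁ * (1 - (a₀ + φ * a₁)) :=
    mul_nonneg (mul_nonneg (by linarith) hb₁) (by linarith)
  have he : 0 ≤ (2 - φ) * (φ * b₀ - b₁ - (φ + 1) * b₂) :=
    mul_nonneg (by linarith) (by linarith)
  have he' : 0 ≤ (2 - φ) * (φ * b₀ - b₁) * (1 - (φ * a₀ + a₂)) :=
    mul_nonneg (mul_nonneg (by linarith) (by nlinarith)) (by linarith)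
  have he₂ := mul_nonneg he ha₂
  have hb' : 0 ≤ (2 - φ) * (1 - (φ * b₀ + (φ - 1) * b₁)) :=
    mul_nonneg (by linarith) (by linarith)
  -- Expand `b` in the cone generators `(1, φ, 0)`, `(φ, 0, 1)`, `(φ, 0, 0)`. The first two pair
  -- with `a` to at most 1, the last to at most `1 - a₂`, and the face inequality for `b` bounds the
  -- sum of the coefficients by `2 - φ`.
  have : 2 - φ - (a₀ * b₀ + a₁ * b₁ + a₂ * b₂) = (φ - 1) * b₁ * (1 - (a₀ + φ * a₁)) +
      (2 - φ) * (φ * b₀ - b₁) * (1 - (φ * a₀ + a₂)) +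
      (2 - φ) * (φ * b₀ - b₁ - (φ + 1) * b₂) * a₂ +
      (2 - φ) * (1 - (φ * b₀ + (φ - 1) * b₁)) := by grind
  linarith

theorem sum_mul_le_of_nonneg {a₀ a₁ a₂ b₀ b₁ b₂ : ℝ} (ha₀ : 0 ≤ a₀) (ha₁ : 0 ≤ a₁) (ha₂ : 0 ≤ a₂)
    (hb₀ : 0 ≤ b₀) (hb₁ : 0 ≤ b₁) (hb₂ : 0 ≤ b₂)
    (h12 : a₁ + φ * a₂ ≤ 1) (h01 : a₀ + φ * a₁ ≤ 1) (h20 : φ * a₀ + a₂ ≤ 1)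
    (hb : b₀ + b₁ + b₂ ≤ 1) (hb01 : φ * b₀ + (φ - 1) * b₁ ≤ 1) (hb12 : φ * b₁ + (φ - 1) * b₂ ≤ 1)
    (hb20 : (φ - 1) * b₀ + φ * b₂ ≤ 1) :
    a₀ * b₀ + a₁ * b₁ + a₂ * b₂ ≤ 2 - φ := by
  rcases le_total (b₁ + (φ + 1) * b₂) (φ * b₀) with h | h0
  · exact sum_mul_le_of_mem_axis_cone ha₂ hb₁ h01 h20 hb01 hb₂ h
  rcases le_total (b₂ + (φ + 1) * b₀) (φ * b₁) with h | h1
  · linarith [sum_mul_le_of_mem_axis_cone ha₀ hb₂ h12 (by linarith) hb12 hb₀ h]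
  rcases le_total (b₀ + (φ + 1) * b₁) (φ * b₂) with h | h2
  · linarith [sum_mul_le_of_mem_axis_cone (a₀ := a₂) (a₁ := a₀) ha₁ hb₀ (by linarith) (by linarith)
      (by linarith) hb₁ h]
  -- Outside the three axis cones, `b` lies over the central face with vertices along `(0, 1, φ)`,
  -- `(1, φ, 0)`, `(φ, 0, 1)`. Its coefficients in these are `(2 - φ) / 2` times the three
  -- nonnegative differences.
  have k0 := mul_nonneg (sub_nonneg.2 h0) (sub_nonneg.2 h12)
  have k1 := mul_nonneg (sub_nonneg.2 h1) (sub_nonneg.2 h20)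
  have k2 := mul_nonneg (sub_nonneg.2 h2) (sub_nonneg.2 h01)
  have hφ := Real.goldenRatio_sq
  have hφ2 := sub_nonneg.2 Real.goldenRatio_lt_two.le
  have k := mul_nonneg hφ2 (add_nonneg (add_nonneg k0 k1) k2)
  have k' := mul_nonneg hφ2 (sub_nonneg.2 hb)
  have : 2 - φ - (a₀ * b₀ + a₁ * b₁ + a₂ * b₂) = (2 - φ) *
      ((b₁ + (φ + 1) * b₂ - φ * b₀) * (1 - (a₁ + φ * a₂)) +
        (b₂ + (φ + 1) * b₀ - φ * b₁) * (1 - (φ * a₀ + a₂)) +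
        (b₀ + (φ + 1) * b₁ - φ * b₂) * (1 - (a₀ + φ * a₁))) / 2 +
      (2 - φ) * (1 - (b₀ + b₁ + b₂)) := by grind
  linarith

theorem icosa_dodeca_bound {u w : Fin 3 → ℝ} (hu : ∀ x, |icosaVec x ⬝ᵥ u| ≤ 1)
    (hw : ∀ y, |dodecaVec y ⬝ᵥ w| ≤ 1) : u 0 * w 0 - u 1 * w 1 + u 2 * w 2 ≤ 2 - φ := by
  rw [forall_icosaVec_dotProduct_le_iff] at hu
  rw [forall_dodecaVec_dotProduct_le_iff] at hw
  refine le_trans ?_ (sum_mul_le_of_nonneg (abs_nonneg (u 0)) (abs_nonneg (u 1)) (abs_nonneg (u 2))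
    (abs_nonneg (w 0)) (abs_nonneg (w 1)) (abs_nonneg (w 2)) hu.1 hu.2.1 hu.2.2 hw.1 hw.2.1 hw.2.2.1
    hw.2.2.2)
  simp only [← abs_mul]
  linarith [le_abs_self (u 0 * w 0), neg_abs_le (u 1 * w 1), le_abs_self (u 2 * w 2)]

/-- The golden-ratio expression in terms of marginals and correlators. -/
theorem goldenI_eq {p : Stat (Fin 2) (Fin 2) (Fin 6) (Fin 10)} {u w : Fin 3 → ℝ}
    {T : Fin 3 → Fin 3 → ℝ}
    (hp : ∀ a b x y, p a b x y = (1 + (-1) ^ (a : ℕ) * (icosaVec x ⬝ᵥ u) +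
      (-1) ^ (b : ℕ) * (dodecaVec y ⬝ᵥ w) +
      (-1) ^ (a : ℕ) * (-1) ^ (b : ℕ) * ∑ i, ∑ j, icosaVec x i * dodecaVec y j * T i j) / 4) :
    goldenI p = (2 * φ - 3) / 2 - (φ - 1) / 2 * (T 0 0 - T 1 1 + T 2 2) := by
  have hφ := Real.goldenRatio_sq
  have hi : 1 / φ ^ 2 = 2 - φ := by
    rw [← one_div_pow, one_div_goldenRatio]
    linear_combination hφ
  simp only [goldenI, hi, one_div_goldenRatio, hp]
  simp only [dotProduct, Fin.sum_univ_three, icosaVec, dodecaVec, one_div_goldenRatio,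
    Matrix.cons_val, Matrix.cons_val_zero, Matrix.cons_val_one]
  simp only [Fin.val_zero, Fin.val_one, pow_zero, pow_one]
  grind

theorem goldenI_productStat (u w : Fin 3 → ℝ) :
    goldenI (productStat (affineResponse icosaVec u) (affineResponse dodecaVec w)) =
      (2 * φ - 3) / 2 - (φ - 1) / 2 * (u 0 * w 0 - u 1 * w 1 + u 2 * w 2) := by
  refine goldenI_eq (u := u) (w := w) (T := fun i j => u i * w j) fun a b x y => ?_
  simp only [productStat_apply, affineResponse, dotProduct, Fin.sum_univ_three]
  ring

theorem isLinearMap_goldenI : IsLinearMap ℝ goldenI := by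
  constructor <;> intros <;> simp only [goldenI, Pi.add_apply, Pi.smul_apply, smul_eq_mul] <;> ring

end Geometry

/-! ### The facet property -/

section Facet

/-- A face `f = 0` of `P` is a facet if every linear functional that takes one constant value on
the face and at one further point of `P` is constant on `P`. -/
theorem isFacetDefining_of_forall_functional {V : Type} [AddCommGroup V] [Module ℝ V]
    [FiniteDimensional ℝ V] {P : Set V} {f : V → ℝ} (hf : IsLinearMap ℝ f) (hP : ∀ p ∈ P, 0 ≤ f p)
    {p₀ p₁ : V} (hp₀ : p₀ ∈ P) (hf₀ : f p₀ = 0) (hp₁ : p₁ ∈ P) (hf₁ : f p₁ ≠ 0)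
    (h : ∀ g : V →ₗ[ℝ] ℝ, (∀ p ∈ P, f p = 0 → g p = g p₁) → ∀ p ∈ P, g p = g p₁) :
    IsFacetDefining P f := by
  set F : Set V := {p ∈ P | f p = 0} with hF
  have hp₀F : p₀ ∈ F := ⟨hp₀, hf₀⟩
  refine ⟨hf, hP, ⟨p₀, hp₀F⟩, ?_⟩
  have hsup : vectorSpan ℝ P ≤ vectorSpan ℝ F ⊔ Submodule.span ℝ {p₁ - p₀} := by
    rw [vectorSpan_def, Submodule.span_le]
    rintro _ ⟨p, hp, q, hq, rfl⟩
    -- A difference outside the sum of the two spans is detected by a functional killing that sum,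
    -- which contradicts `h`.
    by_contra hpq
    obtain ⟨g, hg, hle⟩ := Submodule.exists_le_ker_of_notMem hpq
    have h₁ : g p₁ = g p₀ := by
      have := hle (Submodule.mem_sup_right (Submodule.mem_span_singleton_self (p₁ - p₀)))
      rwa [LinearMap.mem_ker, map_sub, sub_eq_zero] at this
    have hconst := h g fun r hr hr0 => by
      have := hle (Submodule.mem_sup_left (vsub_mem_vectorSpan ℝ (show r ∈ F from ⟨hr, hr0⟩) hp₀F))
      rw [LinearMap.mem_ker, vsub_eq_sub, map_sub, sub_eq_zero] at this
      rw [this, h₁]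
    exact hg (by simp [hconst p hp, hconst q hq])
  have hlt : vectorSpan ℝ F < vectorSpan ℝ P := by
    refine (vectorSpan_mono ℝ fun p hp => hp.1).lt_of_ne fun heq => ?_
    have hmem : p₁ - p₀ ∈ vectorSpan ℝ F := heq ▸ vsub_mem_vectorSpan ℝ hp₁ hp₀
    have hle : vectorSpan ℝ F ≤ LinearMap.ker (hf.mk' f) := by
      rw [vectorSpan_def, Submodule.span_le]
      rintro _ ⟨p, hp, q, hq, rfl⟩
      change hf.mk' f (p - q) = 0
      rw [map_sub]
      simp [hp.2, hq.2]
    have := hle hmem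
    rw [LinearMap.mem_ker, map_sub] at this
    exact hf₁ (by simpa [hf₀] using this)
  have h1 := Submodule.finrank_lt_finrank_of_lt hlt
  have h2 := (Submodule.finrank_mono hsup).trans (Submodule.finrank_add_le_finrank_add_finrank _ _)
  have h3 := finrank_span_le_card (R := ℝ) ({p₁ - p₀} : Set V)
  simp only [Set.toFinset_singleton, Finset.card_singleton] at h3
  change Module.finrank ℝ (vectorSpan ℝ F) + 1 = Module.finrank ℝ (vectorSpan ℝ P)
  omega

/-- The direction of `affineResponse v` along the `i`-th coordinate. -/
noncomputable def responseDirection {X : Type} (v : X → Fin 3 → ℝ) (i : Fin 3) : Fin 2 → X → ℝ :=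
  fun a x => (-1) ^ (a : ℕ) * v x i / 2

theorem affineResponse_eq {X : Type} (v : X → Fin 3 → ℝ) (u : Fin 3 → ℝ) :
    affineResponse v u = affineResponse v 0 + ∑ i, u i • responseDirection v i := by
  ext a x
  simp only [affineResponse, responseDirection, Pi.add_apply, Pi.smul_apply,
    Fin.sum_univ_three, smul_eq_mul, dotProduct, Pi.zero_apply]
  ring

/-- Every functional pulls back to a biaffine function of `(u, w)`, so comparing functionals on the
hull reduces to comparing 15 coefficients. -/
theorem exists_biaffine {X Y : Type} (v : X → Fin 3 → ℝ) (v' : Y → Fin 3 → ℝ)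
    (g : Stat (Fin 2) (Fin 2) X Y →ₗ[ℝ] ℝ) :
    ∃ (c d : Fin 3 → ℝ) (K : Fin 3 → Fin 3 → ℝ), ∀ u w,
      g (productStat (affineResponse v u) (affineResponse v' w)) =
        g (productStat (affineResponse v 0) (affineResponse v' 0)) + ∑ i, u i * c i +
          ∑ j, w j * d j + ∑ i, ∑ j, u i * w j * K i j := by
  refine ⟨fun i => g (productStat (responseDirection v i) (affineResponse v' 0)),
    fun j => g (productStat (affineResponse v 0) (responseDirection v' j)),
    fun i j => g (productStat (responseDirection v i) (responseDirection v' j)), fun u w => ?_⟩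
  rw [affineResponse_eq v u, affineResponse_eq v' w]
  simp only [map_add, map_smul, LinearMap.add_apply, LinearMap.smul_apply, smul_eq_mul,
    Fin.sum_univ_three]
  ring

/-- A biaffine form without constant term that vanishes at the vertices `s` of the cube, paired with
the three vertices of the icosahedron in the (reflected) octant of `s`, is zero. -/
theorem biaffine_eq_zero {c d : Fin 3 → ℝ} {K : Fin 3 → Fin 3 → ℝ}
    (hcyc : ∀ s : Fin 3 → ℝ, (∀ i, s i = 1 ∨ s i = -1) →
      ∀ t ∈ ({![0, -s 1, φ * s 2], ![s 0, -(φ * s 1), 0], ![φ * s 0, 0, s 2]} : Set (Fin 3 → ℝ)),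
        ∑ i, s i * c i + ∑ j, t j * d j + ∑ i, ∑ j, s i * t j * K i j = 0) :
    c = 0 ∧ d = 0 ∧ K = 0 := by
  have hφ := Real.one_lt_goldenRatio
  have h (s₀ s₁ s₂ : ℝ) (h₀ : s₀ = 1 ∨ s₀ = -1) (h₁ : s₁ = 1 ∨ s₁ = -1) (h₂ : s₂ = 1 ∨ s₂ = -1) :=
    hcyc ![s₀, s₁, s₂] (by simp [Fin.forall_fin_succ, h₀, h₁, h₂])
  simp only [Set.mem_insert_iff, Set.mem_singleton_iff, forall_eq_or_imp, forall_eq,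
    Fin.sum_univ_three, Matrix.cons_val, Matrix.cons_val_zero, Matrix.cons_val_one] at h
  obtain ⟨a1, a2, a3⟩ := h 1 1 1 (by simp) (by simp) (by simp)
  obtain ⟨b1, b2, b3⟩ := h 1 1 (-1) (by simp) (by simp) (by simp)
  obtain ⟨c1, c2, c3⟩ := h 1 (-1) 1 (by simp) (by simp) (by simp)
  obtain ⟨d1, d2, d3⟩ := h 1 (-1) (-1) (by simp) (by simp) (by simp)
  obtain ⟨e1, e2, e3⟩ := h (-1) 1 1 (by simp) (by simp) (by simp)
  obtain ⟨f1, f2, f3⟩ := h (-1) 1 (-1) (by simp) (by simp) (by simp)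
  obtain ⟨g1, g2, g3⟩ := h (-1) (-1) 1 (by simp) (by simp) (by simp)
  obtain ⟨k1, k2, k3⟩ := h (-1) (-1) (-1) (by simp) (by simp) (by simp)
  clear h hcyc
  -- Each equation is a polynomial in the signs `s`; combining sign choices isolates the
  -- coefficients of the characters `1`, `s i`, `s i * s j`.
  have C0 : c 0 = 0 := by linarith
  have C1 : c 1 = 0 := by linarith
  have C2 : c 2 = 0 := by linarith
  have D0 : d 0 = 0 := by linarith
  have D1 : d 1 = 0 := by linarith
  have D2 : d 2 = 0 := by linarith
  have K01 : K 0 1 = 0 := by linarith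
  have K12 : K 1 2 = 0 := by linarith
  have K20 : K 2 0 = 0 := by linarith
  -- Products with `φ` are separate atoms for `linarith`.
  have hK01 : φ * K 0 1 = 0 := by rw [K01, mul_zero]
  have hK12 : φ * K 1 2 = 0 := by rw [K12, mul_zero]
  have hK20 : φ * K 2 0 = 0 := by rw [K20, mul_zero]
  have K10 : K 1 0 = 0 := by linarith
  have K21 : K 2 1 = 0 := by linarith
  have K02 : K 0 2 = 0 := by linarith
  -- The sign-independent parts form a cyclic system whose solution is forced to zero by `φ ^ 3 + 1
  -- ≠ 0`.
  have E1 : K 1 1 = φ * K 2 2 := by linarith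
  have E0 : K 0 0 = φ * K 1 1 := by linarith
  have E2 : φ * K 0 0 = -K 2 2 := by linarith
  have K22 : K 2 2 = 0 := by
    rw [E0, E1] at E2
    have : (φ ^ 3 + 1) * K 2 2 = 0 := by linear_combination E2
    exact (mul_eq_zero.1 this).resolve_left (by positivity)
  have K11 : K 1 1 = 0 := by rw [E1, K22, mul_zero]
  have K00 : K 0 0 = 0 := by rw [E0, K11, mul_zero]
  refine ⟨?_, ?_, ?_⟩
  · ext i; fin_cases i <;> assumption
  · ext i; fin_cases i <;> assumption
  · ext i j; fin_cases i <;> fin_cases j <;> assumption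

/-- The tight pairs. The scale `2 - φ = 1 / φ ^ 2` puts both points on the boundary of their polar
solids. -/
theorem noncontextual_vertex_pairs {s : Fin 3 → ℝ} (hs : ∀ i, s i = 1 ∨ s i = -1) {t : Fin 3 → ℝ}
    (ht : t ∈ ({![0, -s 1, φ * s 2], ![s 0, -(φ * s 1), 0], ![φ * s 0, 0, s 2]} :
      Set (Fin 3 → ℝ))) :
    (∀ x, |icosaVec x ⬝ᵥ ((2 - φ) • s)| ≤ 1) ∧ (∀ y, |dodecaVec y ⬝ᵥ ((2 - φ) • t)| ≤ 1) ∧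
      s 0 * t 0 - s 1 * t 1 + s 2 * t 2 = φ + 1 := by
  have habs : ∀ i, |s i| = 1 := fun i => by rcases hs i with h | h <;> simp [h]
  have hsq : ∀ i, s i * s i = 1 := fun i => by rcases hs i with h | h <;> simp [h]
  have hφ := Real.goldenRatio_sq
  have hφ1 := Real.one_lt_goldenRatio
  have hφ2 := Real.goldenRatio_lt_two
  have h2 : |2 - φ| = 2 - φ := abs_of_nonneg (by linarith)
  have h0 : |φ| = φ := abs_of_nonneg (by linarith)
  rw [forall_icosaVec_dotProduct_le_iff, forall_dodecaVec_dotProduct_le_iff]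
  simp only [Pi.smul_apply, smul_eq_mul, abs_mul, habs, h2]
  refine ⟨⟨by nlinarith, by nlinarith, by nlinarith⟩, ?_⟩
  simp only [Set.mem_insert_iff, Set.mem_singleton_iff] at ht
  rcases ht with rfl | rfl | rfl <;> simp [habs, h0, abs_mul] <;>
    refine ⟨⟨?_, ?_, ?_, ?_⟩, ?_⟩ <;> nlinarith [hsq 0, hsq 1, hsq 2]

theorem Scenario.IsIcosaDodeca.NC_aatt_eq {dA dB : ℕ}
    {S : Scenario (Fin 2) (Fin 2) (Fin 6) (Fin 10) dA dB} (hS : S.IsIcosaDodeca) :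
    S.NC .a .a .t .t = convexHull ℝ (Set.image2 (fun ξ η => productStat ξ η)
      (responses (geometricIdentities (antipodal icosaVec)))
      (responses (geometricIdentities (antipodal dodecaVec)))) := by
  rw [S.NC_tt_eq_convexHull, ← hS.1, ← hS.2]
  rfl

theorem Scenario.IsIcosaDodeca.isFacetDefining_goldenI {dA dB : ℕ}
    {S : Scenario (Fin 2) (Fin 2) (Fin 6) (Fin 10) dA dB} (hS : S.IsIcosaDodeca) :
    IsFacetDefining (S.NC .a .a .t .t) goldenI := by
  have hφ := Real.goldenRatio_sq
  have hφ1 := Real.one_lt_goldenRatio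
  have hφ2 := Real.goldenRatio_lt_two
  rw [hS.NC_aatt_eq]
  have hmem : ∀ {u w : Fin 3 → ℝ}, (∀ x, |icosaVec x ⬝ᵥ u| ≤ 1) → (∀ y, |dodecaVec y ⬝ᵥ w| ≤ 1) →
      productStat (affineResponse icosaVec u) (affineResponse dodecaVec w) ∈
        convexHull ℝ (Set.image2 (fun ξ η => productStat ξ η)
          (responses (geometricIdentities (antipodal icosaVec)))
          (responses (geometricIdentities (antipodal dodecaVec)))) := fun hu hw =>
    subset_convexHull ℝ _ ⟨_, mem_responses_geometricIdentities.2 ⟨_, hu, rfl⟩, _,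
      mem_responses_geometricIdentities.2 ⟨_, hw, rfl⟩, rfl⟩
  have hzero : ∀ s : Fin 3 → ℝ, (∀ i, s i = 1 ∨ s i = -1) →
      ∀ t ∈ ({![0, -s 1, φ * s 2], ![s 0, -(φ * s 1), 0], ![φ * s 0, 0, s 2]} : Set (Fin 3 → ℝ)),
        goldenI (productStat (affineResponse icosaVec ((2 - φ) • s))
          (affineResponse dodecaVec ((2 - φ) • t))) = 0 := by
    intro s hs t ht
    have h := (noncontextual_vertex_pairs hs ht).2.2
    rw [goldenI_productStat]
    simp only [Pi.smul_apply, smul_eq_mul]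
    have : (2 - φ) * s 0 * ((2 - φ) * t 0) - (2 - φ) * s 1 * ((2 - φ) * t 1) +
        (2 - φ) * s 2 * ((2 - φ) * t 2) = (2 - φ) ^ 2 * (φ + 1) := by rw [← h]; ring
    rw [this]
    grind
  have hs₁ : ∀ i, (fun _ => 1 : Fin 3 → ℝ) i = 1 ∨ (fun _ => 1 : Fin 3 → ℝ) i = -1 := by simp
  have hv := noncontextual_vertex_pairs hs₁ (Set.mem_insert _ _)
  -- The point off the face is the uniform statistics `u = w = 0`, where every biaffine form reduces
  -- to its constant term.
  refine isFacetDefining_of_forall_functional isLinearMap_goldenI ?_ (hmem hv.1 hv.2.1)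
    (hzero _ hs₁ _ (Set.mem_insert _ _)) (hmem (u := 0) (w := 0) (by simp) (by simp)) ?_ ?_
  · refine convexHull_min ?_ ((convex_Ici (0 : ℝ)).is_linear_preimage isLinearMap_goldenI)
    rintro _ ⟨_, hξ, _, hη, rfl⟩
    obtain ⟨u, hu, rfl⟩ := mem_responses_geometricIdentities.1 hξ
    obtain ⟨w, hw, rfl⟩ := mem_responses_geometricIdentities.1 hη
    change 0 ≤ goldenI _
    rw [goldenI_productStat]
    have := mul_nonneg (sub_nonneg.2 hφ1.le) (sub_nonneg.2 (icosa_dodeca_bound hu hw))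
    nlinarith
  · rw [goldenI_productStat]
    simp only [Pi.zero_apply, mul_zero, sub_zero, add_zero]
    nlinarith
  · intro g hg p hp
    obtain ⟨c, d, K, h⟩ := exists_biaffine icosaVec dodecaVec g
    -- At scaled vertices the linear terms carry one factor `2 - φ` and the bilinear term two; after
    -- one is cancelled, the other stays with `K`.
    obtain ⟨rfl, rfl, hK⟩ := biaffine_eq_zero (c := c) (d := d) (K := (2 - φ) • K) <| by
      intro s hs t ht
      have hv := noncontextual_vertex_pairs hs ht
      have h0 := hg _ (hmem hv.1 hv.2.1) (hzero s hs t ht)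
      rw [h] at h0
      refine (mul_eq_zero.1 (?_ : (2 - φ) * _ = 0)).resolve_left (by linarith : 2 - φ ≠ 0)
      simp only [Fin.sum_univ_three, Pi.smul_apply, smul_eq_mul] at h0 ⊢
      linear_combination h0
    obtain rfl := (smul_eq_zero.1 hK).resolve_left (by linarith : 2 - φ ≠ 0)
    refine convexHull_min (t := g ⁻¹' {g (productStat (affineResponse icosaVec 0)
      (affineResponse dodecaVec 0))}) ?_ ((convex_singleton _).linear_preimage g) hp
    rintro _ ⟨_, hξ, _, hη, rfl⟩
    obtain ⟨u, -, rfl⟩ := mem_responses_geometricIdentities.1 hξ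
    obtain ⟨w, -, rfl⟩ := mem_responses_geometricIdentities.1 hη
    change g _ = _
    simpa using h u w

end Facet

/-! ### Strictness of the inclusions -/

section Strictness

section

variable {A B X Y : Type} [Fintype A] [Fintype B] [Fintype X] [Fintype Y]

/-- Bob's marginal is a mixture of his responses, and the constraint is linear, so it passes from
products to the hull. -/
theorem sum_mul_marginalB_eq_zero {I : Set (A → X → ℝ)} {J : Set (B → Y → ℝ)} {p : Stat A B X Y}
    (hp : p ∈ convexHull ℝ (Set.image2 (fun ξ η => productStat ξ η) (responses I) (responses J)))
    {β : B → Y → ℝ} (hβ : β ∈ J) (x : X) : ∑ b, ∑ y, β b y * ∑ a, p a b x y = 0 := by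
  refine convexHull_min (t := {p : Stat A B X Y | ∑ b, ∑ y, β b y * ∑ a, p a b x y = 0})
    ?_ ?_ hp
  · rintro _ ⟨ξ, hξ, η, hη, rfl⟩
    simpa [← Finset.sum_mul, hξ.2.1] using hη.2.2 β hβ
  · refine convex_hyperplane (f := fun p : Stat A B X Y => ∑ b, ∑ y, β b y * ∑ a, p a b x y)
      ⟨fun p q => ?_, fun r p => ?_⟩ 0
    · simp [Finset.sum_add_distrib, mul_add]
    · simp [← Finset.mul_sum, mul_left_comm _ r]

theorem sum_mul_marginalA_eq_zero {I : Set (A → X → ℝ)} {J : Set (B → Y → ℝ)} {p : Stat A B X Y}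
    (hp : p ∈ convexHull ℝ (Set.image2 (fun ξ η => productStat ξ η) (responses I) (responses J)))
    {α : A → X → ℝ} (hα : α ∈ I) (y : Y) : ∑ a, ∑ x, α a x * ∑ b, p a b x y = 0 := by
  refine convexHull_min (t := {p : Stat A B X Y | ∑ a, ∑ x, α a x * ∑ b, p a b x y = 0})
    ?_ ?_ hp
  · rintro _ ⟨ξ, hξ, η, hη, rfl⟩
    simpa [← Finset.mul_sum, hη.2.1] using hξ.2.2 α hα
  · refine convex_hyperplane (f := fun p : Stat A B X Y => ∑ a, ∑ x, α a x * ∑ b, p a b x y)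
      ⟨fun p q => ?_, fun r p => ?_⟩ 0
    · simp [Finset.sum_add_distrib, mul_add]
    · simp [← Finset.mul_sum, mul_left_comm _ r]

end

theorem alternating_mem_geometricIdentities {X : Type} [Fintype X] {v : X → Fin 3 → ℝ} {γ : X → ℝ}
    (hγ : ∑ x, γ x • v x = 0) :
    (fun (a : Fin 2) x => (-1) ^ (a : ℕ) * γ x) ∈ geometricIdentities (antipodal v) := by
  simp [geometricIdentities, antipodal, hγ]

variable {X : Type} [Fintype X] [DecidableEq X]

theorem trivialIdentities_subset_geometricIdentities (v : X → Fin 3 → ℝ) :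
    trivialIdentities (Fin 2) X ⊆ geometricIdentities (antipodal v) := by
  intro α hα
  obtain ⟨c, hc, h⟩ := exists_of_mem_trivialIdentities hα
  simp [geometricIdentities, h, hc, antipodal]

theorem alternating_notMem_trivialIdentities {γ : X → ℝ} {x₀ : X} (h₀ : γ x₀ ≠ 0) :
    (fun (a : Fin 2) x => (-1) ^ (a : ℕ) * γ x) ∉ trivialIdentities (Fin 2) X := by
  intro h
  obtain ⟨c, -, h⟩ := exists_of_mem_trivialIdentities h
  have h0 := h 0 x₀
  have h1 := h 1 x₀
  simp only [Fin.val_zero, pow_zero, Fin.val_one, pow_one] at h0 h1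
  exact h₀ (by linarith)

/-- Take a deterministic response at `x₀` and uniform ones elsewhere: the uniform terms cancel
between outcomes, leaving `γ x₀`. -/
theorem exists_response_sum_alternating_ne_zero {γ : X → ℝ} {x₀ : X} (h₀ : γ x₀ ≠ 0) :
    ∃ η ∈ responses (trivialIdentities (Fin 2) X),
      ∑ a : Fin 2, ∑ x, (-1) ^ (a : ℕ) * γ x * η a x ≠ 0 := by
  refine ⟨fun a x => if x = x₀ then (if a = 0 then 1 else 0) else 1 / 2,
    mem_responses_trivialIdentities.2 ⟨fun a x => by split_ifs <;> norm_num, fun x => ?_⟩, ?_⟩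
  · by_cases h : x = x₀ <;> simp [h]
  · rw [Fin.sum_univ_two, ← Finset.sum_add_distrib, Finset.sum_eq_single x₀]
    · simpa using h₀
    · intro x _ hx
      simp [hx]
    · simp

theorem affineResponse_zero_mem_responses [Nonempty X] {v : X → Fin 3 → ℝ} {d : ℕ}
    {E : Fin 2 → X → Matrix (Fin d) (Fin d) ℂ}
    (hE : allIdentities E = geometricIdentities (antipodal v)) (i : Kind) :
    affineResponse v 0 ∈ responses (identities i E) := by
  have h : affineResponse v 0 ∈ responses (geometricIdentities (antipodal v)) :=
    mem_responses_geometricIdentities.2 ⟨0, by simp, rfl⟩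
  cases i
  · change _ ∈ responses (allIdentities E)
    rwa [hE]
  · exact responses_anti (trivialIdentities_subset_geometricIdentities v) h

variable {Y : Type} [Fintype Y] [DecidableEq Y] {dA dB : ℕ}
  {S : Scenario (Fin 2) (Fin 2) X Y dA dB} {v : X → Fin 3 → ℝ} {v' : Y → Fin 3 → ℝ}

theorem Scenario.O_ssubset_left (hN : allIdentities S.N = geometricIdentities (antipodal v))
    {γ : X → ℝ} (hγ : ∑ x, γ x • v x = 0) {x₀ : X} (h₀ : γ x₀ ≠ 0) (j k l : Kind) :
    S.O .t j k l ⊂ S.O .a j k l := by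
  refine ⟨?_, fun h => alternating_notMem_trivialIdentities h₀ ?_⟩
  · have h : identities .t S.N ⊆ identities .a S.N :=
      (trivialIdentities_subset_geometricIdentities v).trans hN.ge
    unfold Scenario.O
    gcongr
  · have := h (show OpIdentity.onN _ ∈ S.O .a j k l from
      .inl (.inl (.inl ⟨_, hN.ge (alternating_mem_geometricIdentities hγ), rfl⟩)))
    simpa [Scenario.O, identities] using this

theorem Scenario.O_ssubset_right (hM : allIdentities S.M = geometricIdentities (antipodal v'))
    {γ : Y → ℝ} (hγ : ∑ y, γ y • v' y = 0) {y₀ : Y} (h₀ : γ y₀ ≠ 0) (i k l : Kind) :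
    S.O i .t k l ⊂ S.O i .a k l := by
  refine ⟨?_, fun h => alternating_notMem_trivialIdentities h₀ ?_⟩
  · have h : identities .t S.M ⊆ identities .a S.M :=
      (trivialIdentities_subset_geometricIdentities v').trans hM.ge
    unfold Scenario.O
    gcongr
  · have := h (show OpIdentity.onM _ ∈ S.O i .a k l from
      .inl (.inl (.inr ⟨_, hM.ge (alternating_mem_geometricIdentities hγ), rfl⟩)))
    simpa [Scenario.O, identities] using this

theorem Scenario.NC_anti {i j k l i' j' k' l' : Kind} (h : S.O i j k l ⊆ S.O i' j' k' l') :
    S.NC i' j' k' l' ⊆ S.NC i j k l :=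
  fun _ ⟨k, l, m, hm, ho⟩ => ⟨k, l, m, hm, fun o hoO => ho o (h hoO)⟩

theorem Scenario.NC_ssubset_right [Nonempty X]
    (hN : allIdentities S.N = geometricIdentities (antipodal v))
    (hM : allIdentities S.M = geometricIdentities (antipodal v'))
    {γ : Y → ℝ} (hγ : ∑ y, γ y • v' y = 0) {y₀ : Y} (h₀ : γ y₀ ≠ 0) (i : Kind) :
    S.NC i .a .t .t ⊂ S.NC i .t .t .t := by
  refine ⟨NC_anti (O_ssubset_right hM hγ h₀ i .t .t).le, fun h => ?_⟩
  obtain ⟨η, hη, hne⟩ := exists_response_sum_alternating_ne_zero h₀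
  have hξ := affineResponse_zero_mem_responses hN i
  have hp : productStat (affineResponse v 0) η ∈ S.NC i .t .t .t := by
    rw [NC_tt_eq_convexHull]
    exact subset_convexHull ℝ _ ⟨_, hξ, _, hη, rfl⟩
  have := h hp
  rw [NC_tt_eq_convexHull] at this
  have := sum_mul_marginalB_eq_zero this (hM.ge (alternating_mem_geometricIdentities hγ))
    (Classical.arbitrary X)
  exact hne (by simpa [← Finset.sum_mul, hξ.2.1, -Fin.sum_univ_two] using this)

theorem Scenario.NC_ssubset_left [Nonempty Y]
    (hN : allIdentities S.N = geometricIdentities (antipodal v))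
    (hM : allIdentities S.M = geometricIdentities (antipodal v'))
    {γ : X → ℝ} (hγ : ∑ x, γ x • v x = 0) {x₀ : X} (h₀ : γ x₀ ≠ 0) (j : Kind) :
    S.NC .a j .t .t ⊂ S.NC .t j .t .t := by
  refine ⟨NC_anti (O_ssubset_left hN hγ h₀ j .t .t).le, fun h => ?_⟩
  obtain ⟨ξ, hξ, hne⟩ := exists_response_sum_alternating_ne_zero h₀
  have hη := affineResponse_zero_mem_responses hM j
  have hp : productStat ξ (affineResponse v' 0) ∈ S.NC .t j .t .t := by
    rw [NC_tt_eq_convexHull]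
    exact subset_convexHull ℝ _ ⟨_, hξ, _, hη, rfl⟩
  have := h hp
  rw [NC_tt_eq_convexHull] at this
  have := sum_mul_marginalA_eq_zero this (hN.ge (alternating_mem_geometricIdentities hγ))
    (Classical.arbitrary Y)
  exact hne (by simpa [← Finset.mul_sum, hη.2.1, -Fin.sum_univ_two] using this)

theorem sum_icosaVec_eq_zero : ∑ x, (![φ, φ, -1, 1, 0, 0] : Fin 6 → ℝ) x • icosaVec x = 0 := by
  ext i
  fin_cases i <;> simp [Fin.sum_univ_succ, icosaVec]

theorem sum_dodecaVec_eq_zero :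
    ∑ y, (![1, 0, 0, -1, 0, -1, 0, -1, 0, 0] : Fin 10 → ℝ) y • dodecaVec y = 0 := by
  ext i
  fin_cases i <;> simp [Fin.sum_univ_succ, dodecaVec]

end Strictness

/-! ### Quantum violation -/

section Qubit

theorem geometricIdentities_smul {X : Type} [Fintype X] {r : ℝ} (hr : r ≠ 0)
    (v : X → Fin 3 → ℝ) :
    geometricIdentities (antipodal fun x => r • v x) = geometricIdentities (antipodal v) := by
  have h (α : Fin 2 → X → ℝ) : ∑ a, ∑ x, α a x • antipodal (fun x => r • v x) a x =
      r • ∑ a, ∑ x, α a x • antipodal v a x := by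
    simp only [Finset.smul_sum, antipodal, smul_comm r]
  ext α
  simp only [geometricIdentities, Set.mem_ofPred_eq, h, smul_eq_zero, hr, false_or]

theorem sum_smul_blochMeas {X : Type} [Fintype X] (v : X → Fin 3 → ℝ) (α : Fin 2 → X → ℝ) :
    ∑ a, ∑ x, α a x • blochMeas v a x = (1 / 2 : ℝ) • ((∑ a, ∑ x, α a x) • 1 +
      ∑ i, (∑ a, ∑ x, α a x • antipodal v a x) i • pauli i) := by
  simp only [blochMeas, antipodal, Finset.sum_apply, Pi.smul_apply, Finset.sum_smul, smul_add,
    Finset.smul_sum, Finset.sum_add_distrib, smul_smul, smul_eq_mul]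
  congr 1
  · exact Finset.sum_congr rfl fun a _ => Finset.sum_congr rfl fun x _ => by ring_nf
  · rw [Finset.sum_comm (γ := Fin 3)]
    refine Finset.sum_congr rfl fun a _ => ?_
    rw [Finset.sum_comm (γ := Fin 3)]
    exact Finset.sum_congr rfl fun x _ => Finset.sum_congr rfl fun i _ => by ring_nf

theorem smul_one_add_sum_smul_pauli_eq_zero_iff {r : ℝ} {n : Fin 3 → ℝ} :
    r • (1 : Matrix (Fin 2) (Fin 2) ℂ) + ∑ i, n i • pauli i = 0 ↔ r = 0 ∧ n = 0 := by
  refine ⟨fun h => ?_, fun h => by simp [h.1, h.2]⟩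
  have h00 := congrFun (congrFun h 0) 0
  have h01 := congrFun (congrFun h 0) 1
  have h11 := congrFun (congrFun h 1) 1
  simp [Fin.sum_univ_three, pauli, Complex.ext_iff] at h00 h01 h11
  refine ⟨by linarith, ?_⟩
  ext i
  fin_cases i
  · simpa using h01.1
  · simpa using h01.2
  · simp; linarith

/-- The identity and the Pauli matrices are linearly independent over the reals. -/
theorem allIdentities_blochMeas {X : Type} [Fintype X] (v : X → Fin 3 → ℝ) :
    allIdentities (blochMeas v) = geometricIdentities (antipodal v) := by
  ext α
  simp only [allIdentities, geometricIdentities, Set.mem_ofPred_eq, sum_smul_blochMeas,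
    smul_eq_zero, smul_one_add_sum_smul_pauli_eq_zero_iff]
  norm_num

theorem isPOVMFamily_blochMeas {X : Type} {v : X → Fin 3 → ℝ} (hv : ∀ x, ∑ i, v x i ^ 2 = 1) :
    IsPOVMFamily (blochMeas v) := by
  refine ⟨fun a x => ?_, fun x => ?_⟩
  -- For unit Bloch vectors the effects are projections, so positivity follows from `E = Eᴴ * E`.
  · have hE : (blochMeas v a x).conjTranspose * blochMeas v a x = blochMeas v a x := by
      have h := hv x
      have hs : (((-1 : ℝ) ^ (a : ℕ)) : ℝ) ^ 2 = 1 := by rw [← pow_mul', pow_mul]; simp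
      rw [Fin.sum_univ_three] at h
      unfold blochMeas
      generalize (-1 : ℝ) ^ (a : ℕ) = ε at hs
      ext i j
      fin_cases i <;> fin_cases j <;>
        simp [Matrix.mul_apply, Fin.sum_univ_three, pauli, Complex.ext_iff] <;>
        constructor <;> first | ring1 | linear_combination (ε ^ 2 / 4) * h + hs / 4
    rw [← hE]
    exact Matrix.posSemidef_conjTranspose_mul_self _
  · simp only [blochMeas, Fin.sum_univ_two, Fin.val_zero, pow_zero, Fin.val_one, pow_one, one_smul,
      neg_smul, ← smul_add]
    rw [add_add_add_comm, add_neg_cancel, add_zero, ← two_smul ℝ (1 : Matrix (Fin 2) (Fin 2) ℂ),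
      smul_smul]
    norm_num

theorem isotropic_apply (p : ℝ) (i j k l : Fin 2) :
    isotropic p (i, j) (k, l) =
      p * (if i = j then if k = l then 1 / 2 else 0 else 0) +
        (1 - p) * (if i = k then if j = l then 1 / 4 else 0 else 0) := by
  have h : ((√2 : ℝ) : ℂ)⁻¹ * ((√2 : ℝ) : ℂ)⁻¹ = 2⁻¹ := by
    rw [← mul_inv, ← Complex.ofReal_mul, Real.mul_self_sqrt (by norm_num)]
    norm_num
  fin_cases i <;> fin_cases j <;> fin_cases k <;> fin_cases l <;>
    simp [isotropic, Matrix.vecMulVec, phiPlus, h]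

theorem isDensityMatrix_isotropic {p : ℝ} (h0 : 0 ≤ p) (h1 : p ≤ 1) :
    IsDensityMatrix (isotropic p) := by
  refine ⟨?_, ?_⟩
  · refine ((Matrix.posSemidef_vecMulVec_self_star _).smul h0).add ?_
    exact (Matrix.PosSemidef.one.smul (by norm_num : (0 : ℝ) ≤ 1 / 4)).smul (sub_nonneg.2 h1)
  · simp [Matrix.trace, Fintype.sum_prod_type, Fin.sum_univ_two, isotropic_apply]
    ring

theorem trace_isotropic_mul_kronecker (p : ℝ) {X Y : Type} (v : X → Fin 3 → ℝ) (w : Y → Fin 3 → ℝ)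
    (a b : Fin 2) (x : X) (y : Y) :
    (isotropic p * (blochMeas v a x ⊗ₖ blochMeas w b y)).trace.re =
      (1 + p * ((-1) ^ (a : ℕ) * (-1) ^ (b : ℕ) *
        (v x 0 * w y 0 - v x 1 * w y 1 + v x 2 * w y 2))) / 4 := by
  generalize hr : (-1 : ℝ) ^ (a : ℕ) = r
  generalize hs : (-1 : ℝ) ^ (b : ℕ) = s
  simp [Matrix.trace, Matrix.mul_apply, Fintype.sum_prod_type, Fin.sum_univ_two, isotropic_apply,
    blochMeas, pauli, Fin.sum_univ_three, hr, hs]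
  ring

theorem sum_sq_icosaVec (x : Fin 6) : ∑ i, icosaVec x i ^ 2 = 1 + φ ^ 2 := by
  fin_cases x <;> simp [icosaVec, Fin.sum_univ_three] <;> ring

theorem sum_sq_dodecaVec (y : Fin 10) : ∑ i, dodecaVec y i ^ 2 = 3 := by
  have h : φ ^ 2 + (φ - 1) ^ 2 = 3 := by linear_combination 2 * Real.goldenRatio_sq
  rw [← one_div_goldenRatio] at h
  fin_cases y <;> simp [dodecaVec, Fin.sum_univ_three, -inv_pow] at h ⊢ <;> linarith

theorem sum_sq_normalized {v : Fin 3 → ℝ} {r : ℝ} (hr : 0 < r) (hv : ∑ i, v i ^ 2 = r) :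
    ∑ i, ((1 / √r) • v) i ^ 2 = 1 := by
  simp only [Pi.smul_apply, smul_eq_mul, mul_pow, ← Finset.mul_sum, hv, div_pow, one_pow,
    Real.sq_sqrt hr.le]
  field_simp

theorem isQuantum_qubitScenario {p : ℝ} (h0 : 0 ≤ p) (h1 : p ≤ 1) :
    (qubitScenario p).IsQuantum :=
  ⟨isPOVMFamily_blochMeas fun x => sum_sq_normalized (by positivity) (sum_sq_icosaVec x),
    isPOVMFamily_blochMeas fun y => sum_sq_normalized (by norm_num) (sum_sq_dodecaVec y),
    isDensityMatrix_isotropic h0 h1⟩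

theorem isIcosaDodeca_qubitScenario (p : ℝ) : (qubitScenario p).IsIcosaDodeca := by
  refine ⟨?_, ?_⟩
  · exact (allIdentities_blochMeas _).trans (geometricIdentities_smul (by positivity) _)
  · exact (allIdentities_blochMeas _).trans (geometricIdentities_smul (by positivity) _)

theorem goldenI_qubitScenario (p : ℝ) :
    goldenI (qubitScenario p).statistics =
      (2 * φ - 3) / 2 - (φ - 1) / 2 * (3 * p / (√(1 + φ ^ 2) * √3)) := by
  -- The marginals are uniform; the sign `-1` is the `σ_y ⊗ σ_y` correlation of `Φ⁺`, matching the
  -- sign in the bilinear form.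
  rw [goldenI_eq (u := 0) (w := 0) (T := fun i j =>
    if i = j then p / (√(1 + φ ^ 2) * √3) * ![1, -1, 1] i else 0)]
  · simp only [if_true, Matrix.cons_val]
    ring
  · intro a b x y
    rw [Scenario.statistics, qubitScenario, trace_isotropic_mul_kronecker]
    simp [Fin.sum_univ_three]
    ring

theorem goldenI_qubitScenario_neg {p : ℝ} (hp : √((1 + φ ^ 2) / (3 * φ ^ 4)) < p) :
    goldenI (qubitScenario p).statistics < 0 := by
  have hφ := Real.goldenRatio_sq
  have hφ1 := Real.one_lt_goldenRatio
  have hR : 0 < √(1 + φ ^ 2) := by positivity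
  have h3 : √3 * √3 = 3 := Real.mul_self_sqrt (by norm_num)
  have hs : √((1 + φ ^ 2) / (3 * φ ^ 4)) = √(1 + φ ^ 2) / (√3 * φ ^ 2) := by
    rw [Real.sqrt_div (by positivity), Real.sqrt_mul (by norm_num),
      show φ ^ 4 = (φ ^ 2) ^ 2 by ring, Real.sqrt_sq (by positivity)]
  rw [hs, div_lt_iff₀ (by positivity)] at hp
  have key : 2 - φ < 3 * p / (√(1 + φ ^ 2) * √3) := by
    have h : 3 * p / (√(1 + φ ^ 2) * √3) = p * √3 / √(1 + φ ^ 2) := by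
      field_simp
      rw [sq, h3]
      ring
    rw [h, lt_div_iff₀ hR]
    have := mul_lt_mul_of_pos_left hp (by linarith [Real.goldenRatio_lt_two] : 0 < 2 - φ)
    have e : (2 - φ) * (p * (√3 * φ ^ 2)) = p * √3 := by
      have : (2 - φ) * φ ^ 2 = 1 := by grind
      linear_combination p * √3 * this
    rwa [e] at this
  rw [goldenI_qubitScenario]
  have := mul_lt_mul_of_pos_left key (by linarith : 0 < φ - 1)
  nlinarith

theorem abs_threshold_sub_lt : |√((1 + φ ^ 2) / (3 * φ ^ 4)) - 0.4195| < 0.00005 := by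
  have hφ := Real.goldenRatio_sq
  have hφ1 := Real.one_lt_goldenRatio
  have hl : 1.618 < φ := by nlinarith
  have hu : φ < 1.6181 := by nlinarith
  have h4 : φ ^ 4 = 3 * φ + 2 := by grind
  rw [hφ, h4, abs_lt]
  constructor
  · rw [neg_lt_sub_iff_lt_add, ← sub_lt_iff_lt_add']
    rw [Real.lt_sqrt (by norm_num), lt_div_iff₀ (by positivity)]
    norm_num
    linarith
  · rw [sub_lt_iff_lt_add]
    rw [Real.sqrt_lt' (by norm_num), div_lt_iff₀ (by positivity)]
    norm_num
    linarith

end Qubit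

end Bell

theorem mainTheorem2 :
    (∀ (dA dB : ℕ) (S : Bell.Scenario (Fin 2) (Fin 2) (Fin 6) (Fin 10) dA dB),
      S.IsQuantum → S.IsIcosaDodeca →
        (S.O .t .t .t .t ⊂ S.O .a .t .t .t ∧ S.O .t .t .t .t ⊂ S.O .t .a .t .t ∧
          S.O .a .t .t .t ⊂ S.O .a .a .t .t ∧ S.O .t .a .t .t ⊂ S.O .a .a .t .t) ∧
        (S.NC .a .a .t .t ⊂ S.NC .a .t .t .t ∧ S.NC .a .a .t .t ⊂ S.NC .t .a .t .t ∧
          S.NC .a .t .t .t ⊂ S.NC .t .t .t .t ∧ S.NC .t .a .t .t ⊂ S.NC .t .t .t .t) ∧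
        Bell.IsPolytope (S.NC .a .a .t .t) ∧
        Bell.IsFacetDefining (S.NC .a .a .t .t) Bell.goldenI) ∧
    (∀ p : ℝ, √((1 + φ ^ 2) / (3 * φ ^ 4)) < p → p ≤ 1 →
      (Bell.qubitScenario p).IsQuantum ∧ (Bell.qubitScenario p).IsIcosaDodeca ∧
        Bell.goldenI (Bell.qubitScenario p).statistics < 0) ∧
    |√((1 + φ ^ 2) / (3 * φ ^ 4)) - 0.4195| < 0.00005 := by
  refine ⟨fun dA dB S _ hS => ?_, fun p hp hp1 => ⟨?_, Bell.isIcosaDodeca_qubitScenario p,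
    Bell.goldenI_qubitScenario_neg hp⟩, Bell.abs_threshold_sub_lt⟩
  · have hN : (![φ, φ, -1, 1, 0, 0] : Fin 6 → ℝ) 3 ≠ 0 := by simp
    have hM : (![1, 0, 0, -1, 0, -1, 0, -1, 0, 0] : Fin 10 → ℝ) 0 ≠ 0 := by simp
    exact ⟨⟨Bell.Scenario.O_ssubset_left hS.1 Bell.sum_icosaVec_eq_zero hN _ _ _,
        Bell.Scenario.O_ssubset_right hS.2 Bell.sum_dodecaVec_eq_zero hM _ _ _,
        Bell.Scenario.O_ssubset_right hS.2 Bell.sum_dodecaVec_eq_zero hM _ _ _,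
        Bell.Scenario.O_ssubset_left hS.1 Bell.sum_icosaVec_eq_zero hN _ _ _⟩,
      ⟨Bell.Scenario.NC_ssubset_right hS.1 hS.2 Bell.sum_dodecaVec_eq_zero hM _,
        Bell.Scenario.NC_ssubset_left hS.1 hS.2 Bell.sum_icosaVec_eq_zero hN _,
        Bell.Scenario.NC_ssubset_left hS.1 hS.2 Bell.sum_icosaVec_eq_zero hN _,
        Bell.Scenario.NC_ssubset_right hS.1 hS.2 Bell.sum_dodecaVec_eq_zero hM _⟩,
      S.isPolytope_NC_tt _ _, hS.isFacetDefining_goldenI⟩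
  · exact Bell.isQuantum_qubitScenario ((Real.sqrt_nonneg _).trans hp.le) hp1
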